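/- Let $\mathfrak g$ be a finite-dimensional simple Lie algebra over $\mathbb C$ with Cartan subalgebra $\mathfrak h$, root system $\Phi\subset\mathfrak h^*$, simple roots $\alpha_1,\dots,\alpha_r$, positive roots $\Phi^+$, and Weyl group $W$ generated by the simple reflections $s_1,\dots,s_r$. Let $\rho=\frac12\sum_{\alpha\in\Phi^+}\alpha$, and for $\xi\in\mathfrak h^*$ let $\wp(\xi)$ be the number of ways to write $\xi$ as a linear combination of positive roots with nonnegative integer coefficients. For $\lambda,\mu\in\mathfrak h^*$ put $$\mathcal A(\lambda,\mu)=\{\sigma\in W:\wp(\sigma(\lambda+\rho)-\mu-\rho)>0\}.$$ For $\sigma\in W$, the influence $I(\sigma)$ is the set of $i$ such that $s_i$ occurs in a reduced word for $\sigma$, and $\overline I(\sigma)$ is the set of $i$ that lie in $I(\sigma)$ or are adjacent in the Dynkin diagram to some $j\in I(\sigma)$. The influence of $\sigma$ is connected if the subgraph of the Dynkin diagram induced on $I(\sigma)$ is connected. Elements $\sigma,\tau\in W$ are independent if $I(\sigma)\cap\overline I(\tau)=\emptyset$, and a subset of $W$ is pairwise independent if any two distinct elements of it are independent. Theorem. Let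 $\lambda$ be a dominant integral weight and $\mu$ a weight such that $\mathcal A(\lambda,\mu)$ is nonempty. Then: (1) There is a unique subset $S\subseteq\mathcal A(\lambda,\mu)$ with $1\notin S$ such that every element of $S$ has connected influence and every $\sigma\in\mathcal A(\lambda,\mu)$ is the product of the elements of some (possibly empty) pairwise independent subset of $S$. (2) For this $S$, the product of the elements of a pairwise independent subset of $S$ does not depend on their order, and sending each pairwise independent subset of $S$ to the product of its elements is a bijection onto $\mathcal A(\lambda,\mu)$. -/

import Mathlib

namespace WeylAlternation

section

variable {ι K M N : Type*} [Fintype ι] [Field K] [CharZero K]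
  [AddCommGroup M] [Module K M] [AddCommGroup N] [Module K N]
  {P : RootPairing ι K M N} (b : P.Base)

/-- A weight `v` is integral if `⟨v, α^∨⟩ = 2 (v, α) / (α, α)` is an integer for every root `α`, and
dominant if this number is nonnegative for every positive root `α`. -/
def IsDominantIntegral (v : M) : Prop :=
  ∀ i : ι, ∃ z : ℤ, P.toLinearMap v (P.coroot i) = (z : K) ∧ (b.IsPos i → 0 ≤ z)

open scoped Classical in
/-- The half-sum `ρ` of the positive roots. -/
noncomputable def rho : M :=
  (2⁻¹ : K) • ∑ i : {i : ι // b.IsPos i}, P.root i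

open scoped Classical in
/-- Kostant's partition function: the number of ways to write `ξ` as a linear combination of the
positive roots with nonnegative integer coefficients. The count is taken in `ℕ∞`, so that it has no
junk value. -/
noncomputable def kostantPartition (ξ : M) : ℕ∞ :=
  Set.encard {c : {i : ι // b.IsPos i} → ℕ | ∑ i, c i • P.root i = ξ}

/-- The Weyl alternation set `𝒜(lam, mu)`. -/
def alternationSet (lam mu : M) : Set P.weylGroup :=
  {σ | 0 < kostantPartition b (σ • (lam + rho b) - mu - rho b)}

/-- The product in the Weyl group of a word in the simple reflections `s_i`. -/
noncomputable def wordProd (w : List b.support) : P.weylGroup :=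
  (w.map fun i => RootPairing.weylGroup.ofIdx P (i : ι)).prod

/-- `w` is a reduced word for `σ`: a word for `σ` of minimal length. -/
def IsReducedWord (w : List b.support) (σ : P.weylGroup) : Prop :=
  wordProd b w = σ ∧ ∀ w' : List b.support, wordProd b w' = σ → w.length ≤ w'.length

/-- The Dynkin diagram (without edge labels): distinct simple roots are adjacent when they are not
orthogonal. -/
def dynkinGraph : SimpleGraph b.support where
  Adj i j := i ≠ j ∧ ¬ P.IsOrthogonal (i : ι) (j : ι)
  symm := ⟨fun _ _ h => ⟨h.1.symm, fun h' => h.2 h'.symm⟩⟩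
  loopless := ⟨fun _ h => h.1 rfl⟩

/-- The influence `I(σ)`. -/
def influence (σ : P.weylGroup) : Set b.support :=
  {i | ∃ w, IsReducedWord b w σ ∧ i ∈ w}

/-- The extended influence of `σ`. -/
def extendedInfluence (σ : P.weylGroup) : Set b.support :=
  {i | i ∈ influence b σ ∨ ∃ j ∈ influence b σ, (dynkinGraph b).Adj i j}

/-- The subgraph of the Dynkin diagram induced on `I(σ)` is connected. (The empty graph, which
only occurs for `σ = 1`, counts as connected.) -/
def HasConnectedInfluence (σ : P.weylGroup) : Prop :=
  ((dynkinGraph b).induce (influence b σ)).Preconnected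

/-- `σ` and `τ` are independent. -/
def Independent (σ τ : P.weylGroup) : Prop :=
  influence b σ ∩ extendedInfluence b τ = ∅

/-- Any two distinct elements of `B` are independent. -/
def PairwiseIndependent (B : Set P.weylGroup) : Prop :=
  B.Pairwise (Independent b)

end

/-- The list `l` runs through the elements of the finite set `B`, each exactly once. -/
def Enumerates {G : Type*} (l : List G) (B : Finset G) : Prop :=
  l.Nodup ∧ ∀ x, x ∈ l ↔ x ∈ B

section

variable {ι K M N : Type*} [Fintype ι] [Field K] [CharZero K]
  [AddCommGroup M] [Module K M] [AddCommGroup N] [Module K N]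
  {P : RootPairing ι K M N} (b : P.Base)

/-- `S` is a subset of `𝒜(lam, mu)` not containing `1`, its elements have connected influence, and
each `σ ∈ 𝒜(lam, mu)` is the product of the elements (in some order) of a pairwise independent,
possibly empty, subset of `S`. -/
structure IsBasicSet (lam mu : M) (S : Set P.weylGroup) : Prop where
  subset : S ⊆ alternationSet b lam mu
  one_notMem : 1 ∉ S
  connected : ∀ β ∈ S, HasConnectedInfluence b β
  exists_prod : ∀ σ ∈ alternationSet b lam mu, ∃ B : Finset P.weylGroup,
    (B : Set P.weylGroup) ⊆ S ∧ PairwiseIndependent b (B : Set P.weylGroup) ∧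
      ∃ l : List P.weylGroup, Enumerates l B ∧ l.prod = σ

end

end WeylAlternation

/-!
Put `v = λ + ρ`. It is strictly dominant: every `⟨v, α_i^∨⟩` is a positive integer, because
`⟨ρ, α_i^∨⟩ = 1` (`rho_apply_coroot`). The proof replaces each element `σ` of the Weyl group by its
*displacement*, the coordinate vector of `v - σ v` in the basis of simple roots. If
`s_{i_1} ⋯ s_{i_k}` is a reduced word for `σ`, then

`v - σ v = ∑ j, ⟨v, α_{i_j}^∨⟩ • s_{i_1} ⋯ s_{i_{j-1}} α_{i_j}`,

and by the exchange condition (`exists_wordProd_eq_mul_ofIdx`) all the roots on the right are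
positive. So the displacement has coordinates in `ℕ`, and its support is exactly the set of letters
of the word. Three things follow:

* the influence of `σ` is the support of its displacement (`mem_influence_iff`);
* `σ` is determined by its displacement (`displacement_injective`), since only `1` has the empty
  word as a reduced word;
* `σ` lies in the alternation set if and only if subtracting its displacement from the coordinates
  of `λ - μ` leaves natural numbers (`mem_alternationSet_iff`).

Independent elements fix each other's displacements, so displacements add up over a pairwise
independent set (`displacement_list_prod`), and there the summands have disjoint supports. Hence
such a product does not depend on the order of its factors, and it lies in the alternation set if
and only if every factor does (`list_prod_mem_alternationSet_iff`). Grouping the letters of a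
reduced word by the connected components of the influence factors every `σ` into pairwise
independent elements with connected influence (`exists_pairwiseIndependent_prod_eq`). The influences
of these factors are the connected components of the influence of `σ`, and their displacements are
the restrictions of the displacement of `σ` to these components, so that the factorization is unique
(`subset_of_sum_displacement_eq`). The basic set is therefore the set of all elements `≠ 1` of the
alternation set with connected influence.
-/

namespace WeylAlternation

open RootPairing

section RootSystem

variable {ι K M N : Type*} [Field K]
  [AddCommGroup M] [Module K M] [AddCommGroup N] [Module K N]
  {P : RootPairing ι K M N} (b : P.Base)

/-! ### Words in the simple reflections -/

@[simp] lemma wordProd_nil : wordProd b [] = 1 := rfl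

@[simp] lemma wordProd_cons (i : b.support) (w : List b.support) :
    wordProd b (i :: w) = weylGroup.ofIdx P (i : ι) * wordProd b w := by
  simp [wordProd]

@[simp] lemma wordProd_append (w w' : List b.support) :
    wordProd b (w ++ w') = wordProd b w * wordProd b w' := by
  simp [wordProd]

lemma ofIdx_smul_eq_reflection (i : ι) (x : M) :
    weylGroup.ofIdx P i • x = P.reflection i x := rfl

lemma ofIdx_mul_self (i : ι) : weylGroup.ofIdx P i * weylGroup.ofIdx P i = 1 :=
  Subtype.ext <| mul_eq_one_iff_inv_eq.mpr (Equiv.reflection_inv P i)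

lemma weylGroup_smul_smul (g : P.weylGroup) (a : K) (x : M) : g • a • x = a • g • x :=
  smul_comm (g : P.Aut) a x

lemma exists_smul_root_eq (g : P.weylGroup) (i : ι) : ∃ j, g • P.root i = P.root j :=
  ⟨_, P.weylGroup_apply_root g i⟩

lemma eq_of_forall_smul_eq {g h : P.weylGroup} (H : ∀ x : M, g • x = h • x) : g = h :=
  Subtype.ext <| Equiv.weightHom_injective P <| LinearEquiv.ext H

lemma ofIdx_reflectionPerm (i j : ι) :
    weylGroup.ofIdx P (P.reflectionPerm i j) =
      weylGroup.ofIdx P i * weylGroup.ofIdx P j * weylGroup.ofIdx P i := by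
  refine eq_of_forall_smul_eq fun x => ?_
  simp only [mul_smul, ofIdx_smul_eq_reflection, P.reflection_reflectionPerm]
  rfl

/-- The reflections are permuted by conjugation as the roots are by the action. -/
lemma mul_ofIdx_of_smul_root_eq (g : P.weylGroup) {i j : ι} (h : g • P.root i = P.root j) :
    g * weylGroup.ofIdx P i = weylGroup.ofIdx P j * g := by
  obtain ⟨g, hg⟩ := g
  induction hg using weylGroup.induction generalizing i j with
  | mem k =>
    have hj : P.reflectionPerm k i = j := P.root.injective <| by
      rw [P.root_reflectionPerm, ← h]; rfl
    change weylGroup.ofIdx P k * _ = _ * weylGroup.ofIdx P k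
    rw [← hj, ofIdx_reflectionPerm, mul_assoc, mul_assoc, ofIdx_mul_self, mul_one]
  | one =>
    have hj : i = j := P.root.injective <| by
      rw [← h]; exact (one_smul P.weylGroup (P.root i)).symm
    subst hj
    exact (one_mul _).trans (mul_one _).symm
  | mul x y hx hy ihx ihy =>
    obtain ⟨k, hk⟩ := exists_smul_root_eq ⟨y, hy⟩ i
    have h' : (⟨x, hx⟩ : P.weylGroup) • P.root k = P.root j := by
      rw [← hk, ← h]; exact (mul_smul _ _ _).symm
    change ((⟨x, hx⟩ : P.weylGroup) * ⟨y, hy⟩) * _ = _ * ((⟨x, hx⟩ : P.weylGroup) * ⟨y, hy⟩)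
    rw [mul_assoc, ihy hk, ← mul_assoc, ihx h', mul_assoc]

lemma exists_isReducedWord_of_wordProd (w : List b.support) :
    ∃ w', IsReducedWord b w' (wordProd b w) := by
  classical
  have h : ∃ n, ∃ w' : List b.support, wordProd b w' = wordProd b w ∧ w'.length = n :=
    ⟨_, w, rfl, rfl⟩
  obtain ⟨w', hw', hn⟩ := Nat.find_spec h
  exact ⟨w', hw', fun u hu => hn ▸ Nat.find_min' h ⟨u, hu, rfl⟩⟩

lemma isReducedWord_of_append {w u : List b.support}
    (h : IsReducedWord b (w ++ u) (wordProd b (w ++ u))) : IsReducedWord b w (wordProd b w) := by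
  refine ⟨rfl, fun w' hw' => ?_⟩
  have := h.2 (w' ++ u) (by rw [wordProd_append, wordProd_append, hw'])
  simpa using this

lemma ofIdx_smul_root_of_isOrthogonal {i j : ι} (h : P.IsOrthogonal i j) :
    weylGroup.ofIdx P i • P.root j = P.root j := by
  rw [ofIdx_smul_eq_reflection, P.reflection_apply_root, h.2, zero_smul, sub_zero]

lemma commute_ofIdx_of_isOrthogonal {i j : ι} (h : P.IsOrthogonal i j) :
    Commute (weylGroup.ofIdx P i) (weylGroup.ofIdx P j) :=
  mul_ofIdx_of_smul_root_eq _ (ofIdx_smul_root_of_isOrthogonal h)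

lemma commute_ofIdx_wordProd {i : b.support} {w : List b.support}
    (h : ∀ j ∈ w, P.IsOrthogonal i j) :
    Commute (weylGroup.ofIdx P (i : ι)) (wordProd b w) := by
  induction w with
  | nil => exact Commute.one_right _
  | cons j w ih =>
    rw [wordProd_cons]
    exact (commute_ofIdx_of_isOrthogonal (h j List.mem_cons_self)).mul_right
      (ih fun k hk => h k (List.mem_cons_of_mem _ hk))

lemma wordProd_smul_root_of_isOrthogonal {j : ι} {w : List b.support}
    (h : ∀ i ∈ w, P.IsOrthogonal (i : ι) j) : wordProd b w • P.root j = P.root j := by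
  induction w with
  | nil => simp
  | cons i w ih =>
    rw [wordProd_cons, mul_smul, ih fun k hk => h k (List.mem_cons_of_mem _ hk),
      ofIdx_smul_root_of_isOrthogonal (h i List.mem_cons_self)]

/-- A word can be split along a set of letters that is orthogonal to the remaining letters. -/
lemma wordProd_filter_mul_wordProd_filter_not (p : b.support → Prop) [DecidablePred p]
    {w : List b.support}
    (h : ∀ i ∈ w, ∀ j ∈ w, ¬ p i → p j → P.IsOrthogonal (i : ι) (j : ι)) :
    wordProd b (w.filter p) * wordProd b (w.filter fun i => ¬ p i) = wordProd b w := by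
  induction w with
  | nil => simp
  | cons i w ih =>
    have ih := ih fun k hk l hl => h k (List.mem_cons_of_mem _ hk) l (List.mem_cons_of_mem _ hl)
    by_cases hi : p i
    · rw [List.filter_cons_of_pos (by simpa using hi), List.filter_cons_of_neg (by simpa using hi),
        wordProd_cons, wordProd_cons, mul_assoc, ih]
    · have hc : Commute (weylGroup.ofIdx P (i : ι)) (wordProd b (w.filter p)) := by
        refine commute_ofIdx_wordProd b fun j hj => ?_
        have hj := List.mem_filter.mp hj
        exact h i List.mem_cons_self j (List.mem_cons_of_mem _ hj.1) hi (by simpa using hj.2)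
      rw [List.filter_cons_of_neg (by simpa using hi), List.filter_cons_of_pos (by simpa using hi),
        wordProd_cons, wordProd_cons, ← mul_assoc, ← hc.eq, mul_assoc, ih]

variable [Fintype ι] [CharZero K] [P.IsCrystallographic] [P.IsReduced]

lemma exists_wordProd_eq (σ : P.weylGroup) : ∃ w, wordProd b w = σ := by
  obtain ⟨σ, hσ⟩ := σ
  induction hσ using weylGroup.induction with
  | mem i =>
    change ∃ w, wordProd b w = weylGroup.ofIdx P i
    refine b.induction_reflect i (p := fun i => ∃ w, wordProd b w = weylGroup.ofIdx P i) ?_ ?_ ?_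
    · rintro i ⟨w, hw⟩
      exact ⟨w, by rw [ofIdx_reflectionPerm, ofIdx_mul_self, one_mul, hw]⟩
    · exact fun i hi => ⟨[⟨i, hi⟩], by simp⟩
    · rintro i j ⟨w, hw⟩ hj
      exact ⟨⟨j, hj⟩ :: (w ++ [⟨j, hj⟩]), by simp [hw, ofIdx_reflectionPerm, mul_assoc]⟩
  | one => exact ⟨[], rfl⟩
  | mul x y hx hy ihx ihy =>
    obtain ⟨u, hu⟩ := ihx
    obtain ⟨w, hw⟩ := ihy
    exact ⟨u ++ w, by rw [wordProd_append, hu, hw]; rfl⟩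

lemma exists_isReducedWord (σ : P.weylGroup) : ∃ w, IsReducedWord b w σ := by
  obtain ⟨w, rfl⟩ := exists_wordProd_eq b σ
  exact exists_isReducedWord_of_wordProd b w

/-- The exchange condition: if a word `w` makes the simple root `α_j` negative, then `w s_j` has a
word shorter than `w`. The letter that is deleted is the one at which the image of `α_j` changes
sign, because a simple reflection `s_i` makes no positive root negative but `α_i`. -/
lemma exists_wordProd_eq_mul_ofIdx (w : List b.support) (j : b.support) {k : ι}
    (hk : wordProd b w • P.root j = P.root k) (hneg : ¬ b.IsPos k) :
    ∃ w' : List b.support, w'.length < w.length ∧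
      wordProd b w' = wordProd b w * weylGroup.ofIdx P (j : ι) := by
  induction w generalizing k with
  | nil =>
    rw [wordProd_nil, one_smul] at hk
    exact absurd (P.root.injective hk ▸ Base.isPos_of_mem_support j.2) hneg
  | cons i w ih =>
    obtain ⟨m, hm⟩ := exists_smul_root_eq (wordProd b w) (j : ι)
    rw [wordProd_cons, mul_smul, hm, ofIdx_smul_eq_reflection, ← P.root_reflectionPerm] at hk
    by_cases hpos : b.IsPos m
    · have hmi : m = i := by
        by_contra hne
        exact hneg (P.root.injective hk ▸ hpos.reflectionPerm i.2 hne)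
      subst hmi
      refine ⟨w, by simp, ?_⟩
      rw [wordProd_cons, mul_assoc, mul_ofIdx_of_smul_root_eq _ hm, ← mul_assoc, ofIdx_mul_self,
        one_mul]
    · obtain ⟨w', hlen, hw'⟩ := ih hm hpos
      exact ⟨i :: w', by simpa using hlen, by rw [wordProd_cons, wordProd_cons, hw', mul_assoc]⟩

lemma exists_isPos_of_isReducedWord {w : List b.support} {j : b.support}
    (h : IsReducedWord b (w ++ [j]) (wordProd b (w ++ [j]))) :
    ∃ k, b.IsPos k ∧ wordProd b w • P.root j = P.root k := by
  obtain ⟨k, hk⟩ := exists_smul_root_eq (wordProd b w) (j : ι)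
  refine ⟨k, ?_, hk⟩
  by_contra hneg
  obtain ⟨w', hlen, hw'⟩ := exists_wordProd_eq_mul_ofIdx b w j hk hneg
  have := h.2 w' (by simp [hw'])
  simp only [List.length_append, List.length_singleton] at this
  omega

variable [P.IsRootSystem]

/-! ### The displacement of a strictly dominant weight -/

/-- The coordinates of `v - σ v` in the basis of simple roots. -/
noncomputable def displacement (v : M) (σ : P.weylGroup) : b.support →₀ K :=
  b.toWeightBasis.repr (v - σ • v)

/-- All `⟨v, α_i^∨⟩` for simple roots `α_i` are positive integers. -/
def IsStrictlyDominant (v : M) : Prop :=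
  ∀ i : b.support, ∃ n : ℕ, 0 < n ∧ P.toLinearMap v (P.coroot (i : ι)) = n

omit [P.IsReduced] in
lemma repr_root_of_isPos {k : ι} (hk : b.IsPos k) (i : b.support) :
    ∃ n : ℕ, b.toWeightBasis.repr (P.root k) i = n := by
  classical
  refine hk.induction_on_add (p := fun k => ∃ n : ℕ, b.toWeightBasis.repr (P.root k) i = n)
    (fun j hj => ?_) fun j l k hk ih hl => ?_
  · rw [b.toWeightBasis_repr_root ⟨j, hj⟩, Finsupp.single_apply]
    split_ifs
    · exact ⟨1, by simp⟩
    · exact ⟨0, by simp⟩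
  · obtain ⟨n, hn⟩ := ih
    rw [hk, map_add, Finsupp.add_apply, hn, b.toWeightBasis_repr_root ⟨l, hl⟩, Finsupp.single_apply]
    split_ifs
    · exact ⟨n + 1, by simp⟩
    · exact ⟨n, by simp⟩

omit [Fintype ι] [CharZero K] [P.IsCrystallographic] [P.IsReduced] in
lemma repr_wordProd_smul {i : b.support} {w : List b.support} (hi : i ∉ w) (x : M) :
    b.toWeightBasis.repr (wordProd b w • x) i = b.toWeightBasis.repr x i := by
  induction w with
  | nil => simp
  | cons j w ih =>
    rw [List.mem_cons, not_or] at hi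
    rw [wordProd_cons, mul_smul, ofIdx_smul_eq_reflection, P.reflection_apply, map_sub, LinearEquiv.map_smul,
      Finsupp.sub_apply, ih hi.2, Finsupp.smul_apply, b.toWeightBasis_repr_root,
      Finsupp.single_eq_of_ne hi.1, smul_zero, sub_zero]

variable {b} {v : M}

/-- Appending a letter `j` to a word `w` adds `⟨v, α_j^∨⟩ • w α_j` to `v - w v`. For a reduced word
this is a positive multiple of a positive root, and if `j` is a new letter, then `α_j` has
coefficient `1` in that root and the other new letters do not occur in it. -/
lemma displacement_wordProd_of_isReducedWord (hv : IsStrictlyDominant b v) {w : List b.support}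
    (hw : IsReducedWord b w (wordProd b w)) (i : b.support) :
    ∃ n : ℕ, displacement b v (wordProd b w) i = n ∧ (n ≠ 0 ↔ i ∈ w) := by
  induction w using List.reverseRecOn with
  | nil => exact ⟨0, by simp [displacement]⟩
  | append_singleton w j ih =>
    obtain ⟨n, hn, hn'⟩ := ih (isReducedWord_of_append b hw)
    obtain ⟨a, ha, hva⟩ := hv j
    obtain ⟨k, hk, hjk⟩ := exists_isPos_of_isReducedWord b hw
    obtain ⟨m, hm⟩ := repr_root_of_isPos b hk i
    have key : displacement b v (wordProd b (w ++ [j])) i = (n + a * m : ℕ) := by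
      have : v - wordProd b (w ++ [j]) • v =
          (v - wordProd b w • v) + (a : K) • P.root k := by
        rw [wordProd_append, mul_smul, wordProd_cons, wordProd_nil, mul_one,
          ofIdx_smul_eq_reflection, P.reflection_apply, smul_sub, weylGroup_smul_smul, hjk]
        change v - (_ - P.toLinearMap v (P.coroot (j : ι)) • _) = _
        rw [hva]
        abel
      rw [displacement, this, map_add, map_smul, Finsupp.add_apply, Finsupp.smul_apply, hm]
      rw [displacement] at hn
      rw [hn]
      simp
    refine ⟨_, key, ?_⟩
    by_cases hi : i ∈ w
    · have := hn'.mpr hi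
      simp only [List.mem_append, hi, true_or, iff_true]
      omega
    · have hn0 : n = 0 := by simpa [hi] using hn'
      rw [← hjk, repr_wordProd_smul b hi, b.toWeightBasis_repr_root] at hm
      by_cases hij : i = j
      · subst hij
        have hm1 : m = 1 := by simpa using hm.symm
        simp [hm1, ha.ne']
      · have hm0 : m = 0 := by simpa [Finsupp.single_eq_of_ne hij] using hm.symm
        simp [hm0, hn0, hi, hij]

lemma exists_nat_displacement (hv : IsStrictlyDominant b v) (σ : P.weylGroup) (i : b.support) :
    ∃ n : ℕ, displacement b v σ i = n := by
  obtain ⟨w, hw⟩ := exists_isReducedWord b σ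
  obtain ⟨n, hn, -⟩ := displacement_wordProd_of_isReducedWord hv (hw.1.symm ▸ hw) i
  exact ⟨n, hw.1 ▸ hn⟩

/-- Every reduced word for `σ` has the letters `i` with `displacement b v σ i ≠ 0`. -/
lemma mem_iff_displacement_ne_zero (hv : IsStrictlyDominant b v) {w : List b.support}
    {σ : P.weylGroup} (hw : IsReducedWord b w σ) (i : b.support) :
    i ∈ w ↔ displacement b v σ i ≠ 0 := by
  obtain rfl := hw.1
  obtain ⟨n, hn, hn'⟩ := displacement_wordProd_of_isReducedWord hv hw i
  rw [← hn', hn, Nat.cast_ne_zero]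

lemma mem_influence_iff (hv : IsStrictlyDominant b v) {σ : P.weylGroup} {i : b.support} :
    i ∈ influence b σ ↔ displacement b v σ i ≠ 0 := by
  refine ⟨fun ⟨w, hw, hi⟩ => (mem_iff_displacement_ne_zero hv hw i).mp hi, fun hi => ?_⟩
  obtain ⟨w, hw⟩ := exists_isReducedWord b σ
  exact ⟨w, hw, (mem_iff_displacement_ne_zero hv hw i).mpr hi⟩

omit [Fintype ι] [CharZero K] [P.IsCrystallographic] [P.IsReduced] in
@[simp] lemma displacement_one : displacement b v 1 = 0 := by
  simp [displacement]

lemma eq_one_of_displacement_eq_zero (hv : IsStrictlyDominant b v) {σ : P.weylGroup}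
    (h : displacement b v σ = 0) : σ = 1 := by
  obtain ⟨w, hw⟩ := exists_isReducedWord b σ
  have : w = [] := List.eq_nil_iff_forall_not_mem.mpr fun i hi =>
    (mem_iff_displacement_ne_zero hv hw i).mp hi (by rw [h]; rfl)
  rw [← hw.1, this, wordProd_nil]

/-- The stabilizer of a strictly dominant weight is trivial. -/
lemma displacement_injective (hv : IsStrictlyDominant b v) :
    Function.Injective (displacement b v) := by
  intro σ τ h
  have h' : σ • v = τ • v := sub_right_injective (b.toWeightBasis.repr.injective h)
  rw [← inv_mul_eq_one]
  refine eq_one_of_displacement_eq_zero hv ?_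
  rw [displacement, mul_smul, ← h', inv_smul_smul, sub_self, map_zero]

lemma influence_eq_empty_iff (hv : IsStrictlyDominant b v) {σ : P.weylGroup} :
    influence b σ = ∅ ↔ σ = 1 := by
  refine ⟨fun h => eq_one_of_displacement_eq_zero hv (Finsupp.ext fun i => ?_), ?_⟩
  · by_contra hi
    exact (h ▸ (mem_influence_iff hv).mpr hi : i ∈ (∅ : Set b.support))
  · rintro rfl
    ext i
    simp [mem_influence_iff hv]

lemma influence_wordProd_subset (hv : IsStrictlyDominant b v) {w : List b.support}
    {i : b.support} (hi : i ∈ influence b (wordProd b w)) : i ∈ w := by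
  by_contra h
  rw [mem_influence_iff hv, displacement, map_sub, Finsupp.sub_apply, repr_wordProd_smul b h,
    sub_self] at hi
  exact hi rfl


end RootSystem

section Independence

variable {ι K M N : Type*} [Fintype ι] [Field K] [CharZero K]
  [AddCommGroup M] [Module K M] [AddCommGroup N] [Module K N]
  {P : RootPairing ι K M N} {b : P.Base} {v : M}

/-! ### Half the sum of the positive roots -/

/-- The reflection `s_i` permutes the positive roots other than `α_i` and changes the sign of their
pairings with `α_i^∨`, so that only `α_i` itself contributes to `2 ⟨ρ, α_i^∨⟩`. -/
lemma rho_apply_coroot [P.IsCrystallographic] [P.IsReduced] (i : b.support) :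
    P.toLinearMap (rho b) (P.coroot (i : ι)) = 1 := by
  classical
  have hsum : ∑ k : {k : ι // b.IsPos k}, P.pairing k i = 2 := by
    have hi : b.IsPos (i : ι) := Base.isPos_of_mem_support i.2
    rw [← Finset.add_sum_erase _ _ (Finset.mem_univ (⟨i, hi⟩ : {k : ι // b.IsPos k})),
      P.pairing_same, add_eq_left]
    refine Finset.sum_involution
      (fun k hk => ⟨P.reflectionPerm i k, k.2.reflectionPerm i.2 fun h =>
        (Finset.mem_erase.mp hk).1 (Subtype.ext h)⟩) ?_ ?_ ?_ ?_
    · intro k _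
      rw [← P.pairing_reflectionPerm, P.pairing_reflectionPerm_self_right, add_neg_cancel]
    · intro k _ hne heq
      have h : P.pairing (P.reflectionPerm i k) i = P.pairing k i :=
        congrArg (fun m : {k : ι // b.IsPos k} => P.pairing m i) heq
      rw [← P.pairing_reflectionPerm, P.pairing_reflectionPerm_self_right] at h
      exact hne (self_eq_neg.mp h.symm)
    · intro k hk
      refine Finset.mem_erase.mpr ⟨fun h => ?_, Finset.mem_univ _⟩
      have h1 : P.reflectionPerm i k = i := congrArg Subtype.val h
      have h2 : (k : ι) = P.reflectionPerm i i :=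
        (P.reflectionPerm_self i k).symm.trans (congrArg _ h1)
      have h3 := h2 ▸ k.2
      let := P.indexNeg
      exact (Base.IsPos.neg_iff_not b (i : ι)).mp h3 hi
    · intro k _
      exact Subtype.ext (P.reflectionPerm_self _ _)
  have h2 : (2 : K) ≠ 0 := two_ne_zero
  rw [rho, map_smul, map_sum, LinearMap.smul_apply, LinearMap.sum_apply]
  simp only [P.root_coroot_eq_pairing]
  convert! inv_mul_cancel₀ h2

lemma isStrictlyDominant_add_rho [P.IsCrystallographic] [P.IsReduced]
    (hv : IsDominantIntegral b v) : IsStrictlyDominant b (v + rho b) := by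
  intro i
  obtain ⟨z, hz, hpos⟩ := hv i
  obtain ⟨n, rfl⟩ := Int.eq_ofNat_of_zero_le (hpos (Base.isPos_of_mem_support i.2))
  refine ⟨n + 1, n.succ_pos, ?_⟩
  rw [map_add, LinearMap.add_apply, hz, rho_apply_coroot]
  simp

/-! ### Products of independent elements -/

omit [Fintype ι] [CharZero K] in
lemma independent_iff {σ τ : P.weylGroup} :
    Independent b σ τ ↔
      ∀ i ∈ influence b σ, ∀ j ∈ influence b τ, i ≠ j ∧ ¬ (dynkinGraph b).Adj i j := by
  rw [Independent, Set.eq_empty_iff_forall_notMem]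
  refine ⟨fun h i hi j hj => ⟨?_, fun hij => h i ⟨hi, Or.inr ⟨j, hj, hij⟩⟩⟩, ?_⟩
  · rintro rfl
    exact h i ⟨hi, Or.inl hj⟩
  · rintro h i ⟨hi, hj | ⟨j, hj, hij⟩⟩
    · exact (h i hi i hj).1 rfl
    · exact (h i hi j hj).2 hij

omit [Fintype ι] [CharZero K] in
lemma Independent.symm {σ τ : P.weylGroup} (h : Independent b σ τ) : Independent b τ σ := by
  rw [independent_iff] at h ⊢
  exact fun i hi j hj => ⟨(h j hj i hi).1.symm, fun hij => (h j hj i hi).2 hij.symm⟩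

omit [Fintype ι] [CharZero K] in
lemma isOrthogonal_of_not_adj {i j : b.support} (hij : i ≠ j) (h : ¬ (dynkinGraph b).Adj i j) :
    P.IsOrthogonal (i : ι) (j : ι) := by
  by_contra hort
  exact h ⟨hij, hort⟩

variable [P.IsCrystallographic] [P.IsReduced] [P.IsRootSystem]

lemma Independent.smul_sub_smul (hv : IsStrictlyDominant b v) {σ τ : P.weylGroup}
    (h : Independent b σ τ) : σ • (v - τ • v) = v - τ • v := by
  obtain ⟨w, hw⟩ := exists_isReducedWord b σ
  rw [independent_iff] at h
  rw [← b.toWeightBasis.sum_repr (v - τ • v), Finset.smul_sum]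
  refine Finset.sum_congr rfl fun j _ => ?_
  rw [weylGroup_smul_smul, b.toWeightBasis_apply]
  by_cases hj : b.toWeightBasis.repr (v - τ • v) j = 0
  · rw [hj, zero_smul, zero_smul]
  · rw [← hw.1, wordProd_smul_root_of_isOrthogonal]
    intro i hi
    have := h i ⟨w, hw, hi⟩ j ((mem_influence_iff hv).mpr hj)
    exact isOrthogonal_of_not_adj this.1 this.2

/-- Displacements add up over pairwise independent factors: each factor fixes the displacements of
the others. -/
lemma sub_list_prod_smul (hv : IsStrictlyDominant b v) {l : List P.weylGroup}
    (hl : l.Pairwise (Independent b)) :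
    v - l.prod • v = (l.map fun τ => v - τ • v).sum := by
  induction l with
  | nil => simp
  | cons σ l ih =>
    rw [List.pairwise_cons] at hl
    have hfix : σ • (v - l.prod • v) = v - l.prod • v := by
      rw [ih hl.2, List.smul_sum, List.map_map]
      exact congrArg _ (List.map_congr_left fun τ hτ => (hl.1 τ hτ).smul_sub_smul hv)
    rw [List.prod_cons, List.map_cons, List.sum_cons, ← ih hl.2]
    nth_rw 1 [← hfix]
    rw [smul_sub, mul_smul]
    abel

lemma displacement_list_prod (hv : IsStrictlyDominant b v) {B : Finset P.weylGroup}
    (hB : PairwiseIndependent b (B : Set P.weylGroup)) {l : List P.weylGroup}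
    (hl : Enumerates l B) : displacement b v l.prod = ∑ β ∈ B, displacement b v β := by
  classical
  have hlB : l.toFinset = B := by
    ext x
    rw [List.mem_toFinset, hl.2]
  have hp : l.Pairwise (Independent b) := hl.1.pairwise_of_forall_ne fun x hx y hy hxy =>
    hB ((hl.2 x).mp hx) ((hl.2 y).mp hy) hxy
  rw [displacement, sub_list_prod_smul hv hp, ← hlB, List.sum_toFinset _ hl.1, map_list_sum,
    List.map_map]
  rfl

lemma displacement_mul (hv : IsStrictlyDominant b v) {σ τ : P.weylGroup}
    (h : Independent b σ τ) :
    displacement b v (σ * τ) = displacement b v σ + displacement b v τ := by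
  have := sub_list_prod_smul hv (l := [σ, τ]) (by simpa using h)
  simp only [List.prod_cons, List.prod_nil, mul_one, List.map_cons, List.map_nil, List.sum_cons,
    List.sum_nil, add_zero] at this
  rw [displacement, this, map_add]
  rfl

lemma sum_displacement_apply (hv : IsStrictlyDominant b v) {B : Finset P.weylGroup}
    (hB : PairwiseIndependent b (B : Set P.weylGroup)) {β : P.weylGroup} (hβ : β ∈ B)
    {i : b.support} (hi : i ∈ influence b β) :
    (∑ τ ∈ B, displacement b v τ) i = displacement b v β i := by
  rw [Finsupp.finsetSum_apply]
  refine Finset.sum_eq_single β (fun τ hτ hne => ?_) fun h => absurd hβ h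
  by_contra hi'
  exact (independent_iff.mp (hB hτ hβ hne) i ((mem_influence_iff hv).mpr hi') i hi).1 rfl

lemma sum_displacement_apply_ne_zero_iff (hv : IsStrictlyDominant b v) {B : Finset P.weylGroup}
    (hB : PairwiseIndependent b (B : Set P.weylGroup)) {i : b.support} :
    (∑ τ ∈ B, displacement b v τ) i ≠ 0 ↔ ∃ β ∈ B, i ∈ influence b β := by
  constructor
  · intro h
    rw [Finsupp.finsetSum_apply] at h
    obtain ⟨β, hβ, hne⟩ := Finset.exists_ne_zero_of_sum_ne_zero h
    exact ⟨β, hβ, (mem_influence_iff hv).mpr hne⟩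
  · rintro ⟨β, hβ, hi⟩
    rw [sum_displacement_apply hv hB hβ hi]
    exact (mem_influence_iff hv).mp hi

/-! ### Factorization into elements with connected influence -/

omit [Fintype ι] [CharZero K] [P.IsCrystallographic] [P.IsReduced] [P.IsRootSystem] in
/-- A set that meets a connected influence and is closed under adjacency in it contains it. -/
lemma HasConnectedInfluence.subset {σ : P.weylGroup} (h : HasConnectedInfluence b σ)
    {A : Set b.support} {i : b.support} (hi : i ∈ influence b σ) (hiA : i ∈ A)
    (hA : ∀ j ∈ influence b σ, ∀ k ∈ influence b σ, (dynkinGraph b).Adj j k → j ∈ A → k ∈ A) :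
    influence b σ ⊆ A := by
  intro j hj
  obtain ⟨p⟩ := h ⟨i, hi⟩ ⟨j, hj⟩
  have key : ∀ {x y : influence b σ}, ((dynkinGraph b).induce (influence b σ)).Walk x y →
      (x : b.support) ∈ A → (y : b.support) ∈ A := by
    intro x y p
    induction p with
    | nil => exact id
    | cons hadj _ ih => exact fun hx => ih (hA _ (Subtype.prop _) _ (Subtype.prop _) hadj hx)
  exact key p hiA

omit [Fintype ι] [CharZero K] [P.IsCrystallographic] [P.IsReduced] [P.IsRootSystem] in
/-- A connected influence contained in the influence of a product of pairwise independent elements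
lies in the influence of one of the factors. -/
lemma HasConnectedInfluence.subset_influence {σ : P.weylGroup}
    (h : HasConnectedInfluence b σ) {B : Finset P.weylGroup}
    (hB : PairwiseIndependent b (B : Set P.weylGroup))
    (hσ : ∀ i ∈ influence b σ, ∃ β ∈ B, i ∈ influence b β)
    {β : P.weylGroup} (hβ : β ∈ B) {i : b.support} (hi : i ∈ influence b σ)
    (hiβ : i ∈ influence b β) : influence b σ ⊆ influence b β := by
  refine h.subset hi hiβ fun j hj k hk hadj hjβ => ?_
  obtain ⟨τ, hτ, hkτ⟩ := hσ k hk
  by_cases hne : β = τ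
  · exact hne ▸ hkτ
  · exact absurd hadj (independent_iff.mp (hB hβ hτ hne) j hjβ k hkτ).2

lemma exists_mul_eq_of_ne_one (hv : IsStrictlyDominant b v) {σ : P.weylGroup} (hσ : σ ≠ 1) :
    ∃ β τ, β ≠ 1 ∧ HasConnectedInfluence b β ∧ Independent b β τ ∧ β * τ = σ := by
  classical
  obtain ⟨i, hi⟩ := Set.nonempty_iff_ne_empty.mpr
    (mt (influence_eq_empty_iff hv (b := b)).mp hσ)
  obtain ⟨w, hw⟩ := exists_isReducedWord b σ
  have hwmem (j : b.support) : j ∈ w ↔ j ∈ influence b σ :=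
    (mem_iff_displacement_ne_zero hv hw j).trans (mem_influence_iff hv).symm
  -- the connected component of `i` in the influence of `σ`
  let r : b.support → b.support → Prop := fun j k => k ∈ influence b σ ∧ (dynkinGraph b).Adj j k
  let C : b.support → Prop := Relation.ReflTransGen r i
  have hC : ∀ j ∈ w, ∀ k ∈ w, C j → ¬ C k → j ≠ k ∧ ¬ (dynkinGraph b).Adj j k := by
    intro j _ k hk hCj hCk
    exact ⟨fun h => hCk (h ▸ hCj), fun h => hCk (hCj.tail ⟨(hwmem k).mp hk, h⟩)⟩
  have hprod : wordProd b (w.filter C) * wordProd b (w.filter fun j => ¬ C j) = σ := by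
    rw [wordProd_filter_mul_wordProd_filter_not, hw.1]
    intro j hj k hk hCj hCk
    have := hC k hk j hj hCk hCj
    exact (isOrthogonal_of_not_adj this.1 this.2).symm
  have hsub : ∀ j ∈ influence b (wordProd b (w.filter C)), j ∈ w ∧ C j := fun j hj => by
    simpa using influence_wordProd_subset hv hj
  have hsub' : ∀ j ∈ influence b (wordProd b (w.filter fun j => ¬ C j)), j ∈ w ∧ ¬ C j :=
    fun j hj => by simpa using influence_wordProd_subset hv hj
  have hind : Independent b (wordProd b (w.filter C)) (wordProd b (w.filter fun j => ¬ C j)) :=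
    independent_iff.mpr fun j hj k hk =>
      hC j (hsub j hj).1 k (hsub' k hk).1 (hsub j hj).2 (hsub' k hk).2
  have hCσ : ∀ j, C j → j ∈ influence b σ := by
    intro j hj
    cases hj with
    | refl => exact hi
    | tail _ h => exact h.1
  have hinf (j : b.support) : C j → j ∈ influence b (wordProd b (w.filter C)) := by
    intro hj
    have hjσ := (mem_influence_iff hv).mp (hCσ j hj)
    rw [← hprod, displacement_mul hv hind, Finsupp.add_apply] at hjσ
    have h0 : displacement b v (wordProd b (w.filter fun j => ¬ C j)) j = 0 := by
      by_contra h
      exact (hsub' j ((mem_influence_iff hv).mpr h)).2 hj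
    rw [h0, add_zero] at hjσ
    exact (mem_influence_iff hv).mpr hjσ
  have hreach : ∀ j (hj : C j),
      ((dynkinGraph b).induce (influence b (wordProd b (w.filter C)))).Reachable
        ⟨i, hinf i .refl⟩ ⟨j, hinf j hj⟩ := by
    intro j hj
    induction hj with
    | refl => exact .refl _
    | tail hk h ih => exact ih.trans (SimpleGraph.Adj.reachable (by exact h.2))
  refine ⟨_, _, fun h => ?_, ?_, hind, hprod⟩
  · have := hinf i .refl
    rw [(influence_eq_empty_iff hv).mpr h] at this
    exact this
  · rintro ⟨j, hj⟩ ⟨k, hk⟩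
    exact (hreach j (hsub j hj).2).symm.trans (hreach k (hsub k hk).2)

/-- Every element of the Weyl group is a product of pairwise independent nontrivial elements with
connected influence, one for each connected component of its influence. -/
lemma exists_pairwiseIndependent_prod_eq (hv : IsStrictlyDominant b v) (σ : P.weylGroup) :
    ∃ B : Finset P.weylGroup, (∀ β ∈ B, β ≠ 1 ∧ HasConnectedInfluence b β) ∧
      PairwiseIndependent b (B : Set P.weylGroup) ∧
        ∃ l : List P.weylGroup, Enumerates l B ∧ l.prod = σ := by
  classical
  induction hn : (influence b σ).ncard using Nat.strong_induction_on generalizing σ with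
  | _ n ih =>
    by_cases hσ : σ = 1
    · exact ⟨∅, by simp, by simp [PairwiseIndependent], [], by simp [Enumerates], hσ.symm⟩
    obtain ⟨β, τ, hβ, hconn, hind, rfl⟩ := exists_mul_eq_of_ne_one hv hσ
    obtain ⟨i, hi⟩ := Set.nonempty_iff_ne_empty.mpr
      (mt (influence_eq_empty_iff hv (b := b)).mp hβ)
    have hdisj := independent_iff.mp hind
    have hτ : ∀ j, j ∈ influence b τ → j ∈ influence b (β * τ) ∧ j ∉ influence b β := by
      intro j hj
      have hjβ : j ∉ influence b β := fun h => (hdisj j h j hj).1 rfl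
      refine ⟨?_, hjβ⟩
      rw [mem_influence_iff hv, not_not] at hjβ
      rw [mem_influence_iff hv, displacement_mul hv hind, Finsupp.add_apply, hjβ, zero_add]
      exact (mem_influence_iff hv).mp hj
    have hiσ : i ∈ influence b (β * τ) := by
      have hiτ : displacement b v τ i = 0 := by
        by_contra h
        exact (hdisj i hi i ((mem_influence_iff hv).mpr h)).1 rfl
      rw [mem_influence_iff hv, displacement_mul hv hind, Finsupp.add_apply, hiτ, add_zero]
      exact (mem_influence_iff hv).mp hi
    have hlt : (influence b τ).ncard < n := hn ▸ Set.ncard_lt_ncard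
      ⟨fun j hj => (hτ j hj).1, fun h => (hτ i (h hiσ)).2 hi⟩ (Set.toFinite _)
    obtain ⟨B, hB, hBind, l, hl, rfl⟩ := ih _ hlt τ rfl
    have hβB : ∀ γ ∈ B, Independent b β γ := by
      intro γ hγ
      refine independent_iff.mpr fun j hj k hk => hdisj j hj k ?_
      rw [mem_influence_iff hv, displacement_list_prod hv hBind hl,
        sum_displacement_apply hv hBind hγ hk]
      exact (mem_influence_iff hv).mp hk
    have hnot : β ∉ B := fun h => (independent_iff.mp (hβB β h) i hi i hi).1 rfl
    refine ⟨insert β B, ?_, ?_, β :: l, ⟨?_, ?_⟩, List.prod_cons⟩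
    · intro γ hγ
      obtain rfl | hγ := Finset.mem_insert.mp hγ
      exacts [⟨hβ, hconn⟩, hB γ hγ]
    · rw [Finset.coe_insert]
      exact hBind.insert fun γ hγ _ => ⟨hβB γ hγ, (hβB γ hγ).symm⟩
    · exact List.nodup_cons.mpr ⟨fun h => hnot ((hl.2 β).mp h), hl.1⟩
    · intro γ
      rw [List.mem_cons, Finset.mem_insert, hl.2]

/-- A pairwise independent set of nontrivial elements with connected influence can be recovered from
the product of its elements. -/
lemma subset_of_sum_displacement_eq (hv : IsStrictlyDominant b v) {B B' : Finset P.weylGroup}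
    (hB : PairwiseIndependent b (B : Set P.weylGroup))
    (hB' : PairwiseIndependent b (B' : Set P.weylGroup))
    (hBc : ∀ β ∈ B, β ≠ 1 ∧ HasConnectedInfluence b β)
    (hBc' : ∀ β ∈ B', β ≠ 1 ∧ HasConnectedInfluence b β)
    (h : ∑ β ∈ B, displacement b v β = ∑ β ∈ B', displacement b v β) : B ⊆ B' := by
  intro β hβ
  obtain ⟨i, hi⟩ := Set.nonempty_iff_ne_empty.mpr
    (mt (influence_eq_empty_iff hv (b := b)).mp (hBc β hβ).1)
  have hcover : ∀ j, (∃ γ ∈ B, j ∈ influence b γ) ↔ ∃ γ ∈ B', j ∈ influence b γ := fun j => by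
    rw [← sum_displacement_apply_ne_zero_iff hv hB, ← sum_displacement_apply_ne_zero_iff hv hB', h]
  obtain ⟨β', hβ', hi'⟩ := (hcover i).mp ⟨β, hβ, hi⟩
  have h₁ : influence b β ⊆ influence b β' := (hBc β hβ).2.subset_influence hB'
    (fun j hj => (hcover j).mp ⟨β, hβ, hj⟩) hβ' hi hi'
  have h₂ : influence b β' ⊆ influence b β := (hBc' β' hβ').2.subset_influence hB
    (fun j hj => (hcover j).mpr ⟨β', hβ', hj⟩) hβ hi' hi
  suffices β = β' from this ▸ hβ'
  refine displacement_injective hv (Finsupp.ext fun j => ?_)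
  by_cases hj : j ∈ influence b β
  · rw [← sum_displacement_apply hv hB hβ hj, h, sum_displacement_apply hv hB' hβ' (h₁ hj)]
  · have hj' : j ∉ influence b β' := fun h => hj (h₂ h)
    rw [mem_influence_iff hv, not_not] at hj hj'
    rw [hj, hj']

/-! ### The Weyl alternation set -/

omit [P.IsReduced] in
lemma kostantPartition_pos_iff {ξ : M} :
    0 < kostantPartition b ξ ↔ ∀ i, ∃ n : ℕ, b.toWeightBasis.repr ξ i = n := by
  classical
  rw [kostantPartition, Set.encard_pos]
  constructor
  · rintro ⟨c, rfl⟩ i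
    choose n hn using fun k : {k : ι // b.IsPos k} => repr_root_of_isPos b k.2 i
    refine ⟨∑ k, c k * n k, ?_⟩
    simp [Finsupp.finsetSum_apply, hn]
  · intro h
    choose n hn using h
    refine ⟨fun k => if hk : (k : ι) ∈ b.support then n ⟨k, hk⟩ else 0, ?_⟩
    rw [Set.mem_ofPred_eq, ← b.toWeightBasis.sum_repr ξ]
    simp only [hn, b.toWeightBasis_apply, Nat.cast_smul_eq_nsmul]
    symm
    refine Finset.sum_of_injOn
      (fun i => (⟨i, Base.isPos_of_mem_support i.2⟩ : {k : ι // b.IsPos k})) ?_ ?_ ?_ ?_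
    · intro i _ j _ hij
      exact Subtype.ext (congrArg (fun k : {k : ι // b.IsPos k} => (k : ι)) hij)
    · simp
    · intro k _ hk
      have : (k : ι) ∉ b.support := fun h => hk ⟨⟨k, h⟩, by simp, rfl⟩
      simp [this]
    · intro i _
      simp

omit [P.IsReduced] in
lemma mem_alternationSet_iff {lam mu : M} {σ : P.weylGroup} :
    σ ∈ alternationSet b lam mu ↔ ∀ i, ∃ n : ℕ,
      b.toWeightBasis.repr (lam - mu) i - displacement b (lam + rho b) σ i = n := by
  have : σ • (lam + rho b) - mu - rho b =
      (lam - mu) - ((lam + rho b) - σ • (lam + rho b)) := by abel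
  rw [alternationSet, Set.mem_ofPred_eq, kostantPartition_pos_iff, this]
  simp only [map_sub _ (lam - mu), Finsupp.sub_apply, displacement]

variable {lam mu : M}

lemma one_mem_alternationSet (hlam : IsDominantIntegral b lam)
    (hne : (alternationSet b lam mu).Nonempty) : 1 ∈ alternationSet b lam mu := by
  obtain ⟨σ, hσ⟩ := hne
  refine mem_alternationSet_iff.mpr fun i => ?_
  obtain ⟨m, hm⟩ := exists_nat_displacement (isStrictlyDominant_add_rho hlam) σ i
  obtain ⟨n, hn⟩ := mem_alternationSet_iff.mp hσ i
  refine ⟨n + m, ?_⟩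
  rw [displacement_one, Finsupp.zero_apply, sub_zero, Nat.cast_add, ← hn, ← hm, sub_add_cancel]

/-- A product of pairwise independent elements lies in the alternation set if and only if all the
factors do: their displacements have disjoint supports. -/
lemma list_prod_mem_alternationSet_iff (hlam : IsDominantIntegral b lam)
    (hne : (alternationSet b lam mu).Nonempty) {B : Finset P.weylGroup}
    (hB : PairwiseIndependent b (B : Set P.weylGroup)) {l : List P.weylGroup}
    (hl : Enumerates l B) :
    l.prod ∈ alternationSet b lam mu ↔ (B : Set P.weylGroup) ⊆ alternationSet b lam mu := by
  have hv := isStrictlyDominant_add_rho hlam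
  have h1 := mem_alternationSet_iff.mp (one_mem_alternationSet hlam hne)
  simp only [displacement_one, Finsupp.zero_apply, sub_zero] at h1
  constructor
  · intro h β hβ
    refine mem_alternationSet_iff.mpr fun i => ?_
    by_cases hi : i ∈ influence b β
    · rw [← sum_displacement_apply hv hB hβ hi, ← displacement_list_prod hv hB hl]
      exact mem_alternationSet_iff.mp h i
    · rw [mem_influence_iff hv, not_not] at hi
      rw [hi, sub_zero]
      exact h1 i
  · intro h
    refine mem_alternationSet_iff.mpr fun i => ?_
    rw [displacement_list_prod hv hB hl]
    by_cases hi : ∃ β ∈ B, i ∈ influence b β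
    · obtain ⟨β, hβ, hi⟩ := hi
      rw [sum_displacement_apply hv hB hβ hi]
      exact mem_alternationSet_iff.mp (h hβ) i
    · rw [← sum_displacement_apply_ne_zero_iff hv hB, not_not] at hi
      rw [hi, sub_zero]
      exact h1 i

lemma isBasicSet_setOf (hlam : IsDominantIntegral b lam)
    (hne : (alternationSet b lam mu).Nonempty) :
    IsBasicSet b lam mu
      {β | β ∈ alternationSet b lam mu ∧ β ≠ 1 ∧ HasConnectedInfluence b β} where
  subset _ hβ := hβ.1
  one_notMem h := h.2.1 rfl
  connected _ hβ := hβ.2.2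
  exists_prod σ hσ := by
    obtain ⟨B, hB, hind, l, hl, rfl⟩ :=
      exists_pairwiseIndependent_prod_eq (isStrictlyDominant_add_rho hlam) σ
    exact ⟨B, fun β hβ =>
      ⟨(list_prod_mem_alternationSet_iff hlam hne hind hl).mp hσ hβ, hB β hβ⟩, hind, l, hl, rfl⟩

/-- In a basic set, `β` of connected influence can only be the product of the elements of `{β}`. -/
lemma IsBasicSet.eq_setOf (hlam : IsDominantIntegral b lam) {S : Set P.weylGroup}
    (hS : IsBasicSet b lam mu S) :
    S = {β | β ∈ alternationSet b lam mu ∧ β ≠ 1 ∧ HasConnectedInfluence b β} := by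
  have hv := isStrictlyDominant_add_rho hlam
  have hsub : ∀ β ∈ S, β ≠ 1 ∧ HasConnectedInfluence b β := fun β hβ =>
    ⟨fun h => hS.one_notMem (h ▸ hβ), hS.connected β hβ⟩
  refine Set.Subset.antisymm (fun β hβ => ⟨hS.subset hβ, hsub β hβ⟩) ?_
  rintro β ⟨hβ, hβc⟩
  obtain ⟨B, hBS, hB, l, hl, rfl⟩ := hS.exists_prod β hβ
  refine hBS (subset_of_sum_displacement_eq hv (B := {l.prod}) ?_ hB ?_
    (fun γ hγ => hsub γ (hBS hγ)) ?_ (Finset.mem_singleton_self _))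
  · simp [PairwiseIndependent]
  · simpa using hβc
  · rw [Finset.sum_singleton, displacement_list_prod hv hB hl]

lemma IsBasicSet.exists_equiv (hlam : IsDominantIntegral b lam)
    (hne : (alternationSet b lam mu).Nonempty) {S : Set P.weylGroup}
    (hS : IsBasicSet b lam mu S) :
    ∃ e : {B : Finset P.weylGroup //
          (B : Set P.weylGroup) ⊆ S ∧ PairwiseIndependent b (B : Set P.weylGroup)} ≃
        alternationSet b lam mu,
      ∀ B, ∀ l : List P.weylGroup, Enumerates l B.1 → l.prod = (e B : _) := by
  have hv := isStrictlyDominant_add_rho hlam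
  have hsub : ∀ β ∈ S, β ≠ 1 ∧ HasConnectedInfluence b β := fun β hβ =>
    ⟨fun h => hS.one_notMem (h ▸ hβ), hS.connected β hβ⟩
  have henum (B : Finset P.weylGroup) : Enumerates B.toList B :=
    ⟨B.nodup_toList, fun _ => Finset.mem_toList⟩
  let f : {B : Finset P.weylGroup //
        (B : Set P.weylGroup) ⊆ S ∧ PairwiseIndependent b (B : Set P.weylGroup)} →
      alternationSet b lam mu := fun B => ⟨B.1.toList.prod,
    (list_prod_mem_alternationSet_iff hlam hne B.2.2 (henum B.1)).mpr (B.2.1.trans hS.subset)⟩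
  have hf (B) (l : List P.weylGroup) (hl : Enumerates l B.1) : l.prod = (f B : P.weylGroup) :=
    displacement_injective hv <|
      (displacement_list_prod hv B.2.2 hl).trans
        (displacement_list_prod hv B.2.2 (henum B.1)).symm
  refine ⟨Equiv.ofBijective f ⟨fun B B' h => ?_, fun ⟨σ, hσ⟩ => ?_⟩, hf⟩
  · have h' : ∑ β ∈ B.1, displacement b (lam + rho b) β =
        ∑ β ∈ B'.1, displacement b (lam + rho b) β := by
      rw [← displacement_list_prod hv B.2.2 (henum B.1),
        ← displacement_list_prod hv B'.2.2 (henum B'.1)]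
      exact congrArg (displacement b (lam + rho b)) (congrArg Subtype.val h)
    have hc := fun β (hβ : β ∈ B.1) => hsub β (B.2.1 hβ)
    have hc' := fun β (hβ : β ∈ B'.1) => hsub β (B'.2.1 hβ)
    exact Subtype.ext <| Finset.Subset.antisymm
      (subset_of_sum_displacement_eq hv B.2.2 B'.2.2 hc hc' h')
      (subset_of_sum_displacement_eq hv B'.2.2 B.2.2 hc' hc h'.symm)
  · obtain ⟨B, hBS, hB, l, hl, rfl⟩ := hS.exists_prod σ hσ
    exact ⟨⟨B, hBS, hB⟩, Subtype.ext (hf ⟨B, hBS, hB⟩ l hl).symm⟩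

end Independence

end WeylAlternation

theorem mainTheorem2 {𝔤 : Type*} [LieRing 𝔤] [LieAlgebra ℂ 𝔤] [FiniteDimensional ℂ 𝔤]
    [LieAlgebra.IsSimple ℂ 𝔤] (H : LieSubalgebra ℂ 𝔤) [H.IsCartanSubalgebra]
    (b : (LieAlgebra.IsKilling.rootSystem H).Base) (lam mu : Module.Dual ℂ H)
    (hlam : WeylAlternation.IsDominantIntegral b lam)
    (hne : (WeylAlternation.alternationSet b lam mu).Nonempty) :
    (∃! S : Set (LieAlgebra.IsKilling.rootSystem H).weylGroup,
      WeylAlternation.IsBasicSet b lam mu S) ∧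
    ∀ S : Set (LieAlgebra.IsKilling.rootSystem H).weylGroup,
      WeylAlternation.IsBasicSet b lam mu S →
      ∃ e : {B : Finset (LieAlgebra.IsKilling.rootSystem H).weylGroup //
            (B : Set (LieAlgebra.IsKilling.rootSystem H).weylGroup) ⊆ S ∧
              WeylAlternation.PairwiseIndependent b
                (B : Set (LieAlgebra.IsKilling.rootSystem H).weylGroup)} ≃
          WeylAlternation.alternationSet b lam mu,
        ∀ B, ∀ l : List (LieAlgebra.IsKilling.rootSystem H).weylGroup,
          WeylAlternation.Enumerates l B.1 → l.prod = (e B : _) := by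
  refine ⟨⟨_, WeylAlternation.isBasicSet_setOf hlam hne, fun S hS => hS.eq_setOf hlam⟩,
    fun S hS => hS.exists_equiv hlam hne⟩
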